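/- All graphs are finite and simple; $G+H$ denotes the disjoint union of graphs and $\overline{G}$ the complement. A graph is a *cograph* if it has no induced path $P_4$ on four vertices. A graph $G$ is *$2$-polar* if $V(G)$ can be partitioned into sets $A$ and $B$ (possibly empty) such that $A$ induces a complete multipartite graph with at most $2$ parts and $B$ induces a disjoint union of at most $2$ cliques, with no other edges. A *cograph minimal $2$-polar obstruction* is a cograph that is not $2$-polar, but all of whose proper induced subgraphs are $2$-polar. A *partial complement* of $G$ is a graph $\overline{G'}+\overline{G''}$, where $G'$ and $G''$ are obtained by splitting the connected components of $G$ into two (possibly empty) families; if one of the families is empty, this is the complement $\overline{G}$. Let $$F_1=K_1+3K_2,\qquad F_6=2P_3+K_2,\qquad F_{13}=C_4+K_2+2K_1,\qquad F_{21}=K_{3,3}+3K_1.$$ **Theorem.** A graph is a cograph minimal $2$-polar obstruction if and only if it is isomorphic to a graph obtained from one of $F_1, F_6, F_{13}, F_{21}$ by a finite (possibly empty) sequence of partial complementations. Moreover, under the equivalence relation "one graph is, up to isomorphism, obtained from the other by a sequence of partial complementations", the cograph minimal $2$-polar obstructions form exactly four equivalence classes (namely those of $F_1$, $F_6$, $F_{13}$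 and $F_{21}$, which are pairwise inequivalent). -/

import Mathlib

universe u v w

namespace PolarCograph

open SimpleGraph

/-- A cograph: a graph with no induced path on four vertices. -/
def IsCograph {V : Type u} (G : SimpleGraph V) : Prop :=
  ¬ (pathGraph 4).IsIndContained G

/-- `(s, k)`-polar graphs: the vertex set splits into `A` and its complement, where `A` induces a
complete multipartite graph with at most `s` parts (the fibres of `f`; fibres may be empty) and
the complement of `A` induces a disjoint union of at most `k` cliques (the fibres of `g`), with no
other edges. -/
def IsPolar {V : Type u} (s k : ℕ) (G : SimpleGraph V) : Prop :=
  ∃ A : Set V,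
    (∃ f : A → Fin s, ∀ a b : A, G.Adj a b ↔ f a ≠ f b) ∧
    (∃ g : (Aᶜ : Set V) → Fin k, ∀ a b : (Aᶜ : Set V), G.Adj a b ↔ a ≠ b ∧ g a = g b)

/-- Minimal `k`-polar obstructions: graphs that are not `k`-polar, while each of their proper
induced subgraphs is. -/
def IsMinimalPolarObstruction {V : Type u} (k : ℕ) (G : SimpleGraph V) : Prop :=
  ¬ IsPolar k k G ∧ ∀ S : Set V, S ≠ Set.univ → IsPolar k k (G.induce S)

/-- The partial complement of `G` for a splitting of its connected components into those in `C` and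
those not in `C`: the disjoint union of the complements of the two resulting graphs. One side may
be empty, and then this is the complement of `G`. -/
def partialCompl {V : Type u} (G : SimpleGraph V) (C : Set G.ConnectedComponent) :
    SimpleGraph V where
  Adj a b := a ≠ b ∧ (G.connectedComponentMk a ∈ C ↔ G.connectedComponentMk b ∈ C) ∧ ¬ G.Adj a b
  symm := ⟨fun _ _ h => ⟨h.1.symm, h.2.1.symm, fun h' => h.2.2 h'.symm⟩⟩
  loopless := ⟨fun _ h => h.1 rfl⟩

/-- `G'` is a partial complement of `G` (on the same vertex set). -/
def IsPartialCompl {V : Type u} (G G' : SimpleGraph V) : Prop :=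
  ∃ C : Set G.ConnectedComponent, G' = partialCompl G C

/-- `H` is, up to isomorphism, obtained from `G` by a finite (possibly empty) sequence of partial
complementations. -/
def PartialComplReachable {V : Type u} {W : Type v} (G : SimpleGraph V) (H : SimpleGraph W) :
    Prop :=
  ∃ G' : SimpleGraph V, Relation.ReflTransGen IsPartialCompl G G' ∧ Nonempty (G' ≃g H)

theorem isPartialCompl_iff {V : Type u} {G G' : SimpleGraph V} :
    IsPartialCompl G G' ↔ ∃ S : Set V, (∀ a b, G.Adj a b → (a ∈ S ↔ b ∈ S)) ∧
      ∀ a b, G'.Adj a b ↔ a ≠ b ∧ (a ∈ S ↔ b ∈ S) ∧ ¬ G.Adj a b := by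
  constructor
  · rintro ⟨C, rfl⟩
    refine ⟨{a | G.connectedComponentMk a ∈ C}, fun a b h => ?_, fun a b => Iff.rfl⟩
    simp only [Set.mem_ofPred_eq, ConnectedComponent.sound h.reachable]
  · rintro ⟨S, hS, h⟩
    have key : ∀ a, G.connectedComponentMk a ∈ G.connectedComponentMk '' S ↔ a ∈ S := by
      intro a
      refine ⟨?_, fun ha => ⟨a, ha, rfl⟩⟩
      rintro ⟨b, hb, hab⟩
      obtain ⟨p⟩ := ConnectedComponent.exact hab
      induction p with
      | nil => exact hb
      | cons e _ ih => exact ih ((hS _ _ e).1 hb) (ConnectedComponent.sound ⟨by assumption⟩)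
    refine ⟨G.connectedComponentMk '' S, ?_⟩
    ext a b
    rw [h]
    simp only [partialCompl, key]

theorem IsPartialCompl.symm {V : Type u} {G G' : SimpleGraph V} (h : IsPartialCompl G G') :
    IsPartialCompl G' G := by
  rw [isPartialCompl_iff] at h ⊢
  obtain ⟨S, hS, h⟩ := h
  refine ⟨S, fun a b hab => ((h a b).1 hab).2.1, fun a b => ?_⟩
  rw [h]
  refine ⟨fun hab => ⟨hab.ne, hS a b hab, fun h' => h'.2.2 hab⟩, fun h' => ?_⟩
  by_contra hab
  exact h'.2.2 ⟨h'.1, h'.2.1, hab⟩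

theorem IsPartialCompl.comap {V : Type u} {W : Type v} (e : W ≃ V) {G G' : SimpleGraph V}
    (h : IsPartialCompl G G') : IsPartialCompl (G.comap e) (G'.comap e) := by
  rw [isPartialCompl_iff] at h ⊢
  obtain ⟨S, hS, h⟩ := h
  refine ⟨e ⁻¹' S, fun a b hab => hS _ _ hab, fun a b => ?_⟩
  simp [h]

theorem PartialComplReachable.refl {V : Type u} (G : SimpleGraph V) :
    PartialComplReachable G G :=
  ⟨G, .refl, ⟨Iso.refl⟩⟩

theorem reflTransGen_symm {V : Type u} {G G' : SimpleGraph V}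
    (h : Relation.ReflTransGen IsPartialCompl G G') :
    Relation.ReflTransGen IsPartialCompl G' G := by
  induction h with
  | refl => exact .refl
  | tail _ h ih => exact (Relation.ReflTransGen.single h.symm).trans ih

theorem reflTransGen_comap {V : Type u} {W : Type v} (e : W ≃ V) {G G' : SimpleGraph V}
    (h : Relation.ReflTransGen IsPartialCompl G G') :
    Relation.ReflTransGen IsPartialCompl (G.comap e) (G'.comap e) := by
  induction h with
  | refl => exact .refl
  | tail _ h ih => exact ih.tail (h.comap e)

theorem PartialComplReachable.symm {V : Type u} {W : Type v} {G : SimpleGraph V}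
    {H : SimpleGraph W} (h : PartialComplReachable G H) : PartialComplReachable H G := by
  obtain ⟨G', hG, ⟨e⟩⟩ := h
  have hH : G'.comap e.symm.toEquiv = H := by
    ext a b
    exact e.symm.map_adj_iff
  refine ⟨G.comap e.symm.toEquiv, ?_, ⟨⟨e.symm.toEquiv, Iff.rfl⟩⟩⟩
  have h := reflTransGen_comap e.symm.toEquiv (reflTransGen_symm hG)
  rwa [hH] at h

theorem PartialComplReachable.trans {V : Type u} {W : Type v} {X : Type w} {G : SimpleGraph V}
    {H : SimpleGraph W} {K : SimpleGraph X} (h : PartialComplReachable G H)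
    (h' : PartialComplReachable H K) : PartialComplReachable G K := by
  obtain ⟨G', hG, ⟨e⟩⟩ := h
  obtain ⟨H', hH, ⟨e'⟩⟩ := h'
  have hG' : H.comap e.toEquiv = G' := by
    ext a b
    exact e.map_adj_iff
  refine ⟨H'.comap e.toEquiv, hG.trans ?_, ⟨(⟨e.toEquiv, Iff.rfl⟩ : _ ≃g H').trans e'⟩⟩
  have h := reflTransGen_comap e.toEquiv hH
  rwa [hG'] at h

/-- The finite graphs, up to isomorphism: graphs on some `Fin n`. -/
abbrev FinGraph : Type := Σ n : ℕ, SimpleGraph (Fin n)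

/-- Two finite graphs are related if one is, up to isomorphism, obtained from the other by a
sequence of partial complementations. -/
def partialComplSetoid : Setoid FinGraph where
  r G H := PartialComplReachable G.2 H.2
  iseqv :=
    { refl := fun G => PartialComplReachable.refl G.2
      symm := fun h => h.symm
      trans := fun h h' => h.trans h' }

/-- The equivalence classes, under partial complementation, of the cographs that are minimal
`2`-polar obstructions. -/
def obstructionClasses : Set (Quotient partialComplSetoid) :=
  (fun G => Quotient.mk partialComplSetoid G) ''
    {G : FinGraph | IsCograph G.2 ∧ IsMinimalPolarObstruction 2 G.2}

/-- `F₁ = K₁ + 3K₂`. -/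
def F1 : SimpleGraph (Fin 1 ⊕ Fin 2 ⊕ Fin 2 ⊕ Fin 2) :=
  completeGraph (Fin 1) ⊕g (completeGraph (Fin 2) ⊕g (completeGraph (Fin 2) ⊕g
    completeGraph (Fin 2)))

/-- `F₆ = 2P₃ + K₂`. -/
def F6 : SimpleGraph (Fin 3 ⊕ Fin 3 ⊕ Fin 2) :=
  pathGraph 3 ⊕g (pathGraph 3 ⊕g completeGraph (Fin 2))

/-- `F₁₃ = C₄ + K₂ + 2K₁`. -/
def F13 : SimpleGraph (Fin 4 ⊕ Fin 2 ⊕ Fin 1 ⊕ Fin 1) :=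
  cycleGraph 4 ⊕g (completeGraph (Fin 2) ⊕g (completeGraph (Fin 1) ⊕g completeGraph (Fin 1)))

/-- `F₂₁ = K₃,₃ + 3K₁`. -/
def F21 : SimpleGraph ((Fin 3 ⊕ Fin 3) ⊕ Fin 1 ⊕ Fin 1 ⊕ Fin 1) :=
  completeBipartiteGraph (Fin 3) (Fin 3) ⊕g (completeGraph (Fin 1) ⊕g (completeGraph (Fin 1) ⊕g
    completeGraph (Fin 1)))

end PolarCograph

/-! Complete bipartite graphs (with empty parts allowed) are those in which every triple of vertices
spans an even number of edges; unions of at most two cliques are those in which every triple spans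
an odd number. So `2`-polarity depends only on the parities of triples. A partial complement flips
every one of these parities, which merely exchanges the two sides of a partition. Cographs are also
preserved, so the obstructions form whole equivalence classes.

It remains to find a convenient member of each class. Seinsche's theorem, together with partial
complementation, turns every non-`2`-polar cograph into one with three mutually nonadjacent parts,
each having an edge (`exists_isTripod`). If such a graph avoids `K₁ + 3K₂`, `2P₃ + K₂`, `diamond +
2K₂` and `3K₃`, it is `2`-polar (`IsTripod.exists_embedding`). By minimality an obstruction of this
shape is one of these four graphs; the last two are partial complements of `F13` and `F21`.

The classes are told apart by the number of vertices and, for the two on eight vertices, by the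
number of odd triples up to complementation. -/

namespace PolarCograph

open SimpleGraph

variable {V : Type u} {W : Type v}

/-! ### Polarity as a parity condition on triples -/

/-- The vertices `a`, `b`, `c` span an odd number of edges. -/
def OddTriple (G : SimpleGraph V) (a b c : V) : Prop :=
  G.Adj a b ↔ (G.Adj b c ↔ G.Adj a c)

/-- Every triple of distinct vertices of `A` spans an even number of edges, and every triple of
distinct vertices outside `A` an odd number. -/
def IsParityPartition (G : SimpleGraph V) (A : Set V) : Prop :=
  ∀ a b c, a ≠ b → b ≠ c → a ≠ c →
    (a ∈ A → b ∈ A → c ∈ A → ¬ OddTriple G a b c) ∧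
    (a ∉ A → b ∉ A → c ∉ A → OddTriple G a b c)

/-- Parity determines the parts: once a base vertex is fixed, adjacency to it gives a two-colouring,
and the parity of the triples through it forces all other adjacencies. -/
theorem isPolar_two_two_iff {G : SimpleGraph V} :
    IsPolar 2 2 G ↔ ∃ A, IsParityPartition G A := by
  constructor
  · rintro ⟨A, ⟨f, hf⟩, ⟨g, hg⟩⟩
    refine ⟨A, fun a b c hab hbc hac => ⟨fun ha hb hc => ?_, fun ha hb hc => ?_⟩⟩
    · have h1 := hf ⟨a, ha⟩ ⟨b, hb⟩
      have h2 := hf ⟨b, hb⟩ ⟨c, hc⟩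
      have h3 := hf ⟨a, ha⟩ ⟨c, hc⟩
      simp only at h1 h2 h3
      rw [OddTriple, h1, h2, h3]
      generalize f ⟨a, ha⟩ = x, f ⟨b, hb⟩ = y, f ⟨c, hc⟩ = z
      revert x y z
      decide
    · have h1 := hg ⟨a, ha⟩ ⟨b, hb⟩
      have h2 := hg ⟨b, hb⟩ ⟨c, hc⟩
      have h3 := hg ⟨a, ha⟩ ⟨c, hc⟩
      simp only [ne_eq, Subtype.mk.injEq, hab, hbc, hac, not_false_eq_true, true_and] at h1 h2 h3
      rw [OddTriple, h1, h2, h3]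
      generalize g ⟨a, ha⟩ = x, g ⟨b, hb⟩ = y, g ⟨c, hc⟩ = z
      revert x y z
      decide
  · rintro ⟨A, hA⟩
    classical
    refine ⟨A, ?_, ?_⟩
    · rcases A.eq_empty_or_nonempty with rfl | ⟨o, ho⟩
      · exact ⟨fun _ => 0, fun a => a.2.elim⟩
      refine ⟨fun a => if G.Adj o a then 1 else 0, fun a b => ?_⟩
      have key : ¬ OddTriple G o a b := by
        by_cases h1 : o = a
        · simp [OddTriple, h1]
        by_cases h2 : (a : V) = b
        · simp [OddTriple, h2]
        by_cases h3 : o = b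
        · simp [OddTriple, h3, G.adj_comm]
        exact (hA _ _ _ h1 h2 h3).1 ho a.2 b.2
      rw [OddTriple] at key
      dsimp only
      split_ifs <;> simp_all
    · rcases (Aᶜ).eq_empty_or_nonempty with h | ⟨o, ho⟩
      · exact ⟨fun _ => 0, fun a => absurd a.2 (by simp [h])⟩
      refine ⟨fun a => if o = a ∨ G.Adj o a then 1 else 0, fun a b => ?_⟩
      by_cases h2 : a = b
      · simp [h2]
      have h2' : (a : V) ≠ b := fun h => h2 (Subtype.ext h)
      by_cases h1 : o = a
      · have h3 : o ≠ b := by rwa [h1]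
        simp [← h1, h3, h2]
      by_cases h3 : o = b
      · simp [← h3, h1, h2, G.adj_comm]
      have key := (hA _ _ _ h1 h2' h3).2 ho a.2 b.2
      rw [OddTriple] at key
      simp only [h1, h3, false_or]
      split_ifs <;> simp_all

/-- A splitting `S` leaves either all three pairs of the triple or exactly one inside a side. Those
pairs are flipped, while a separated pair is a non-edge before and after, so an odd number of
adjacencies changes. -/
theorem IsPartialCompl.oddTriple_iff {G G' : SimpleGraph V} (h : IsPartialCompl G G') {a b c : V}
    (hab : a ≠ b) (hbc : b ≠ c) (hac : a ≠ c) : OddTriple G' a b c ↔ ¬ OddTriple G a b c := by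
  rw [isPartialCompl_iff] at h
  obtain ⟨S, hS, h⟩ := h
  have h1 := hS a b
  have h2 := hS b c
  have h3 := hS a c
  simp only [OddTriple, h, ne_eq, hab, hbc, hac, not_false_eq_true, true_and]
  by_cases ha : a ∈ S <;> by_cases hb : b ∈ S <;> by_cases hc : c ∈ S <;>
    simp only [ha, hb, hc, iff_true, iff_false, not_true, imp_false,
      implies_true, true_and, false_and] at h1 h2 h3 ⊢ <;>
    by_cases g1 : G.Adj a b <;> by_cases g2 : G.Adj b c <;> by_cases g3 : G.Adj a c <;> simp_all

theorem IsPartialCompl.isPolar {G G' : SimpleGraph V} (h : IsPartialCompl G G')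
    (hG : IsPolar 2 2 G) : IsPolar 2 2 G' := by
  rw [isPolar_two_two_iff] at hG ⊢
  obtain ⟨A, hA⟩ := hG
  refine ⟨Aᶜ, fun a b c hab hbc hac => ?_⟩
  have := hA a b c hab hbc hac
  rw [h.oddTriple_iff hab hbc hac]
  simp only [Set.mem_compl_iff, not_not]
  exact ⟨this.2, this.1⟩

theorem IsPartialCompl.induce {G G' : SimpleGraph V} (h : IsPartialCompl G G') (T : Set V) :
    IsPartialCompl (G.induce T) (G'.induce T) := by
  rw [isPartialCompl_iff] at h ⊢
  obtain ⟨S, hS, h⟩ := h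
  refine ⟨Subtype.val ⁻¹' S, fun a b hab => hS a b hab, fun a b => ?_⟩
  simp [h, Subtype.ext_iff]

theorem IsPartialCompl.isMinimalPolarObstruction {G G' : SimpleGraph V} (h : IsPartialCompl G G')
    (hG : IsMinimalPolarObstruction 2 G) : IsMinimalPolarObstruction 2 G' :=
  ⟨fun hp => hG.1 (h.symm.isPolar hp), fun S hS => (h.induce S).isPolar (hG.2 S hS)⟩

/-! ### Cographs under complementation -/

theorem isCograph_iff {G : SimpleGraph V} :
    IsCograph G ↔ ∀ a b c d, G.Adj a b → G.Adj b c → G.Adj c d →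
      G.Adj a c ∨ G.Adj b d ∨ G.Adj a d := by
  rw [IsCograph, not_iff_comm]
  push Not
  constructor
  · rintro ⟨a, b, c, d, hab, hbc, hcd, hac, hbd, had⟩
    have h1 : a ≠ c := by rintro rfl; exact had hcd
    have h2 : b ≠ d := by rintro rfl; exact had hab
    have h3 : a ≠ d := by rintro rfl; exact hac hcd.symm
    refine ⟨⟨⟨![a, b, c, d], ?_⟩, ?_⟩⟩
    · intro i j
      fin_cases i <;> fin_cases j <;>
        simp [hab.ne, hbc.ne, hcd.ne, h1, h2, h3, hab.ne', hbc.ne', hcd.ne', h1.symm, h2.symm,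
          h3.symm]
    · intro i j
      change G.Adj (![a, b, c, d] i) (![a, b, c, d] j) ↔ _
      fin_cases i <;> fin_cases j <;>
        simp [pathGraph_adj, hab, hbc, hcd, hac, hbd, had, hab.symm, hbc.symm, hcd.symm,
          G.adj_comm c a, G.adj_comm d b, G.adj_comm d a]
  · rintro ⟨e⟩
    refine ⟨e 0, e 1, e 2, e 3, ?_⟩
    simp [e.map_adj_iff, pathGraph_adj]

/-- `P₄` is self-complementary: a path `a b c d` in the complement is the path `b d a c` in the
graph. -/
theorem IsCograph.compl {G : SimpleGraph V} (hG : IsCograph G) : IsCograph Gᶜ := by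
  rw [isCograph_iff] at hG ⊢
  intro a b c d hab hbc hcd
  by_contra! h
  have h1 : a ≠ c := by rintro rfl; exact h.2.2 hcd
  have h2 : b ≠ d := by rintro rfl; exact h.2.2 hab
  have h3 : a ≠ d := by rintro rfl; exact h.1 hcd.symm
  simp only [compl_adj, h1, h2, h3, ne_eq, not_false_eq_true, true_and, not_not] at *
  have := hG b d a c h.2.1 h.2.2.symm h.1
  simp only [G.adj_comm b a, G.adj_comm d c] at this
  tauto

/-- An induced path in a partial complement is connected, so it lies within one side, where the
graph is an ordinary complement. -/
theorem IsPartialCompl.isCograph {G G' : SimpleGraph V} (h : IsPartialCompl G G')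
    (hG : IsCograph G) : IsCograph G' := by
  rw [isPartialCompl_iff] at h
  obtain ⟨S, -, h⟩ := h
  have hG := hG.compl
  rw [isCograph_iff] at hG ⊢
  intro a b c d hab hbc hcd
  have h4 := hG a b c d
  simp only [compl_adj, h] at *
  tauto

/-! ### Transport along embeddings and isomorphisms -/

theorem isPolar_of_embedding {k l : ℕ} {G : SimpleGraph V} {H : SimpleGraph W} (e : H ↪g G)
    (hG : IsPolar k l G) : IsPolar k l H := by
  obtain ⟨A, ⟨f, hf⟩, ⟨g, hg⟩⟩ := hG
  refine ⟨e ⁻¹' A, ⟨fun a => f ⟨e a, a.2⟩, fun a b => ?_⟩, ⟨fun a => g ⟨e a, a.2⟩, fun a b => ?_⟩⟩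
  · rw [← hf, e.map_adj_iff]
  · have := hg ⟨e a, a.2⟩ ⟨e b, b.2⟩
    simpa [Subtype.ext_iff] using this

theorem isMinimalPolarObstruction_of_iso {G : SimpleGraph V} {H : SimpleGraph W} (e : G ≃g H)
    (hG : IsMinimalPolarObstruction 2 G) : IsMinimalPolarObstruction 2 H := by
  refine ⟨fun h => hG.1 (isPolar_of_embedding e.toEmbedding h), fun S hS => ?_⟩
  refine isPolar_of_embedding (G := G.induce (e ⁻¹' S))
    ⟨⟨fun a => ⟨e.symm a, by simp⟩, fun a b hab => ?_⟩, ?_⟩ (hG.2 _ ?_)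
  · simpa [Subtype.ext_iff] using hab
  · exact e.symm.map_adj_iff
  · intro h
    refine hS (Set.eq_univ_of_forall fun a => ?_)
    have : e.symm a ∈ e ⁻¹' S := h ▸ Set.mem_univ _
    simpa using this

theorem isCograph_of_iso {G : SimpleGraph V} {H : SimpleGraph W} (e : G ≃g H)
    (hG : IsCograph G) : IsCograph H := by
  rw [isCograph_iff] at hG ⊢
  intro a b c d
  simpa [e.symm.map_adj_iff] using hG (e.symm a) (e.symm b) (e.symm c) (e.symm d)

/-- A cograph that is a minimal `2`-polar obstruction. -/
def IsCographObstruction (G : SimpleGraph V) : Prop :=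
  IsCograph G ∧ IsMinimalPolarObstruction 2 G

theorem IsCographObstruction.of_reflTransGen {G G' : SimpleGraph V} (hG : IsCographObstruction G)
    (h : Relation.ReflTransGen IsPartialCompl G G') : IsCographObstruction G' := by
  induction h with
  | refl => exact hG
  | tail _ h ih => exact ⟨h.isCograph ih.1, h.isMinimalPolarObstruction ih.2⟩

theorem IsCographObstruction.of_reachable {G : SimpleGraph V} {H : SimpleGraph W}
    (hG : IsCographObstruction G) (h : PartialComplReachable G H) : IsCographObstruction H := by
  obtain ⟨G', hG', ⟨e⟩⟩ := h
  have := hG.of_reflTransGen hG'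
  exact ⟨isCograph_of_iso e this.1, isMinimalPolarObstruction_of_iso e this.2⟩

theorem reachable_of_iso {G : SimpleGraph V} {H : SimpleGraph W} (e : G ≃g H) :
    PartialComplReachable G H :=
  ⟨G, .refl, ⟨e⟩⟩

/-- A minimal obstruction is isomorphic to every obstruction that it contains. -/
theorem IsMinimalPolarObstruction.nonempty_iso {G : SimpleGraph V} {H : SimpleGraph W}
    (hG : IsMinimalPolarObstruction 2 G) (e : H ↪g G) (hH : ¬ IsPolar 2 2 H) :
    Nonempty (H ≃g G) := by
  have hr : Set.range e = Set.univ := by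
    by_contra h
    refine hH (isPolar_of_embedding (G := G.induce (Set.range e))
      ⟨⟨fun a => ⟨e a, a, rfl⟩, fun a b hab => ?_⟩, ?_⟩ (hG.2 _ h))
    · simpa [Subtype.ext_iff] using hab
    · exact e.map_adj_iff
  exact ⟨RelIso.ofSurjective e (Set.range_eq_univ.1 hr)⟩

/-! ### Seinsche's theorem -/

/-- `U` has a nonempty proper subset `S` with all or no edges between `S` and `U \ S`. -/
def IsDecomposable (G : SimpleGraph V) (U : Finset V) : Prop :=
  ∃ S : Set V, (∃ a ∈ U, a ∈ S) ∧ (∃ a ∈ U, a ∉ S) ∧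
    ((∀ a ∈ U, ∀ b ∈ U, a ∈ S → b ∉ S → ¬ G.Adj a b) ∨
      (∀ a ∈ U, ∀ b ∈ U, a ∈ S → b ∉ S → G.Adj a b))

theorem IsDecomposable.compl {G : SimpleGraph V} {U : Finset V} (h : IsDecomposable G U) :
    IsDecomposable Gᶜ U := by
  obtain ⟨S, h1, h2, h⟩ := h
  refine ⟨S, h1, h2, h.symm.imp (fun h a ha b hb haS hbS => ?_) (fun h a ha b hb haS hbS => ?_)⟩
  · simp [h a ha b hb haS hbS]
  · rw [compl_adj]
    exact ⟨fun hab => hbS (hab ▸ haS), h a ha b hb haS hbS⟩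

/-- If the new vertex `v` is not joined to everything, take the component `C` of a non-neighbour.
Either `v` has no neighbour in `C`, or, as there is no induced `P₄`, it has none outside `C`. -/
theorem isDecomposable_insert [DecidableEq V] {G : SimpleGraph V} (hG : IsCograph G) {U : Finset V}
    {v : V} (hv : v ∉ U) {S : Set V} (h1 : ∃ a ∈ U, a ∈ S) (h2 : ∃ a ∈ U, a ∉ S)
    (hS : ∀ a ∈ U, ∀ b ∈ U, a ∈ S → b ∉ S → ¬ G.Adj a b) : IsDecomposable G (insert v U) := by
  rw [isCograph_iff] at hG
  by_cases hall : ∀ y ∈ U, G.Adj v y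
  · obtain ⟨a, ha, -⟩ := h1
    refine ⟨{v}, ⟨v, by simp⟩, ⟨a, by simp [ha], fun h => hv ?_⟩, Or.inr ?_⟩
    · rw [Set.mem_singleton_iff] at h; exact h ▸ ha
    · rintro a - b hb rfl hbv
      rcases Finset.mem_insert.1 hb with rfl | hb
      · exact (hbv rfl).elim
      · exact hall b hb
  push Not at hall
  obtain ⟨y, hy, hvy⟩ := hall
  let r : V → V → Prop := fun a b => a ∈ U ∧ b ∈ U ∧ G.Adj a b
  let C : Set V := {z | Relation.ReflTransGen r y z}
  have hyC : y ∈ C := Relation.ReflTransGen.refl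
  have hCU : ∀ z ∈ C, z ∈ U := by
    intro z hz
    induction hz with
    | refl => exact hy
    | tail _ h _ => exact h.2.1
  have hC : ∀ a ∈ U, ∀ b ∈ U, a ∈ C → b ∉ C → ¬ G.Adj a b :=
    fun a ha b hb haC hbC hab => hbC (Relation.ReflTransGen.tail haC ⟨ha, hb, hab⟩)
  -- The component stays on one side of the cut `S`, hence is not all of `U`.
  have hCS : ∀ z ∈ C, z ∈ S ↔ y ∈ S := by
    intro z hz
    induction hz with
    | refl => rfl
    | @tail b c _ h ih =>
      rw [← ih]
      have h3 := hS b h.1 c h.2.1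
      have h4 := hS c h.2.1 b h.1
      have h5 := h.2.2
      have h6 := h.2.2.symm
      tauto
  have hproper : ∃ a ∈ U, a ∉ C := by
    by_cases hyS : y ∈ S
    · obtain ⟨a, ha, haS⟩ := h2
      exact ⟨a, ha, fun h => haS ((hCS a h).2 hyS)⟩
    · obtain ⟨a, ha, haS⟩ := h1
      exact ⟨a, ha, fun h => hyS ((hCS a h).1 haS)⟩
  by_cases hx : ∃ x ∈ C, G.Adj v x
  -- Walking from `y` to a neighbour of `v` inside `C`, some edge leads from a non-neighbour to a
  -- neighbour of `v`.
  · have hstep : ∃ y' x', G.Adj y' x' ∧ y' ∈ C ∧ x' ∈ C ∧ ¬ G.Adj v y' ∧ G.Adj v x' := by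
      obtain ⟨x, hxC, hvx⟩ := hx
      by_contra! hno
      have : ∀ z ∈ C, ¬ G.Adj v z := by
        intro z hz
        induction hz with
        | refl => exact hvy
        | @tail b c hb h ih => exact hno b c h.2.2 hb (Relation.ReflTransGen.tail hb h) ih
      exact this x hxC hvx
    obtain ⟨y', x', hyx, hy', hx', hvy', hvx'⟩ := hstep
    obtain ⟨a, ha, haC⟩ := hproper
    refine ⟨insert v C, ⟨v, by simp⟩, ⟨a, by simp [ha], ?_⟩, Or.inl ?_⟩
    · rintro (rfl | h)
      · exact hv ha
      · exact haC h
    · rintro p hp q hq hpC hqC hpq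
      have hqv : q ≠ v := fun h => hqC (Or.inl h)
      have hqU : q ∈ U := (Finset.mem_insert.1 hq).resolve_left hqv
      have hqC' : q ∉ C := fun h => hqC (Or.inr h)
      rcases hpC with rfl | hpC
      -- Here `p` is the new vertex, so a neighbour `q` outside `C` would make `y' x' p q` an
      -- induced path.
      · rcases hG y' x' p q hyx hvx'.symm hpq with h | h | h
        · exact hvy' h.symm
        · exact hC x' (hCU _ hx') q hqU hx' hqC' h
        · exact hC y' (hCU _ hy') q hqU hy' hqC' h
      · exact hC p (hCU _ hpC) q hqU hpC hqC' hpq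
  · push Not at hx
    refine ⟨C, ⟨y, by simp [hy], hyC⟩, ⟨v, by simp, fun h => hv (hCU _ h)⟩, Or.inl ?_⟩
    intro p hp q hq hpC hqC hpq
    rcases Finset.mem_insert.1 hq with rfl | hq
    · exact hx p hpC hpq.symm
    · exact hC p (hCU _ hpC) q hq hpC hqC hpq

/-- Seinsche: a cograph on at least two vertices, or its complement, is disconnected. -/
theorem IsCograph.isDecomposable {G : SimpleGraph V} (hG : IsCograph G) (U : Finset V)
    (hU : U.Nontrivial) : IsDecomposable G U := by
  classical
  induction U using Finset.induction_on with
  | empty => simp at hU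
  | insert v U hv ih =>
    by_cases hU' : U.Nontrivial
    · obtain ⟨S, h1, h2, h | h⟩ := ih hU'
      · exact isDecomposable_insert hG hv h1 h2 h
      · rw [← compl_compl G]
        refine (isDecomposable_insert hG.compl hv h1 h2 fun a ha b hb haS hbS => ?_).compl
        simp [h a ha b hb haS hbS]
    · rw [Finset.Nontrivial, Set.not_nontrivial_iff] at hU'
      obtain ⟨a, ha, hav⟩ := hU.exists_ne v
      have haU : a ∈ U := (Finset.mem_insert.1 ha).resolve_left hav
      have hUa : ∀ b ∈ U, b = a := fun b hb => hU' hb haU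
      refine ⟨{v}, ⟨v, by simp, rfl⟩, ⟨a, ha, hav⟩, ?_⟩
      by_cases hva : G.Adj v a
      · right
        rintro p - q hq rfl hqp
        rwa [hUa q ((Finset.mem_insert.1 hq).resolve_left hqp)]
      · left
        rintro p - q hq rfl hqp
        rwa [hUa q ((Finset.mem_insert.1 hq).resolve_left hqp)]

/-! ### Split graphs and the reduction to three nontrivial parts -/

/-- `G` restricted to `S` is a split graph. -/
def IsSplitOn (G : SimpleGraph V) (S : Set V) : Prop :=
  ∃ A : Set V, (∀ a ∈ S, ∀ b ∈ S, a ∈ A → b ∈ A → ¬ G.Adj a b) ∧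
    (∀ a ∈ S, ∀ b ∈ S, a ∉ A → b ∉ A → a ≠ b → G.Adj a b)

/-- `p` splits `G` into three parts with no edges between them, each part having an edge. -/
def IsTripod (G : SimpleGraph V) (p : V → Fin 3) : Prop :=
  (∀ a b, G.Adj a b → p a = p b) ∧ ∀ i, ∃ a b, G.Adj a b ∧ p a = i ∧ p b = i

theorem isSplitOn_of_edgeless_left {G : SimpleGraph V} {S T : Set V}
    (hST : ∀ a ∈ S, ∀ b ∈ T, ¬ G.Adj a b) (hS : ∀ a ∈ S, ∀ b ∈ S, ¬ G.Adj a b)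
    (hT : IsSplitOn G T) : IsSplitOn G (S ∪ T) := by
  obtain ⟨A, h1, h2⟩ := hT
  refine ⟨S ∪ A, ?_, ?_⟩
  · rintro a (ha | ha) b (hb | hb) hA hB hab
    · exact hS a ha b hb hab
    · exact hST a ha b hb hab
    · exact hST b hb a ha hab.symm
    · rcases hA with hA | hA
      · exact hST a hA b hb hab
      rcases hB with hB | hB
      · exact hST b hB a ha hab.symm
      exact h1 a ha b hb hA hB hab
  · rintro a ha b hb hA hB
    rw [Set.mem_union, not_or] at hA hB
    exact h2 a (ha.resolve_left hA.1) b (hb.resolve_left hB.1) hA.2 hB.2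

/-- The two cliques make up one side. The two independent sets, with all the isolated vertices
outside `S ∪ T`, form a single independent part. -/
theorem isPolar_of_isSplitOn {G : SimpleGraph V} {S T : Set V}
    (hd : ∀ a ∈ S, a ∉ T) (hST : ∀ a ∈ S, ∀ b ∈ T, ¬ G.Adj a b)
    (hU : ∀ a b, G.Adj a b → a ∈ S ∪ T)
    (hS : IsSplitOn G S) (hT : IsSplitOn G T) : IsPolar 2 2 G := by
  classical
  obtain ⟨A, hA1, hA2⟩ := hS
  obtain ⟨B, hB1, hB2⟩ := hT
  refine ⟨{a | (a ∈ S → a ∈ A) ∧ (a ∈ T → a ∈ B)}, ⟨fun _ => 0, fun a b => ?_⟩,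
    ⟨fun a => if (a : V) ∈ S then 0 else 1, fun a b => ?_⟩⟩
  · simp only [ne_eq, not_true_eq_false, iff_false]
    intro hab
    have ha := a.2
    have hb := b.2
    simp only [Set.mem_ofPred_eq] at ha hb
    have h1 := hU _ _ hab
    have h2 := hU _ _ hab.symm
    have h3 := hST a
    have h4 := hST b
    have h5 := hA1 a
    have h6 := hB1 a
    have h7 := hab.symm
    rcases h1 with h1 | h1 <;> rcases h2 with h2 | h2 <;> grind
  · have ha := a.2
    have hb := b.2
    simp only [Set.mem_compl_iff, Set.mem_ofPred_eq, not_and_or, Classical.not_imp] at ha hb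
    have h1 := hST a
    have h2 := hST b
    have h3 := hA2 a
    have h4 := hB2 a
    have h5 : a = b ↔ (a : V) = b := Subtype.ext_iff
    have h6 := hd a
    have h7 := hd b
    have h8 := G.adj_comm a b
    have h9 : (a : V) = b → ¬ G.Adj a b := fun h => by simp [h]
    rcases ha with ha | ha <;> rcases hb with hb | hb <;> grind


/-- Complementing a split graph exchanges its clique and its independent set. -/
theorem isSplitOn_of_partialCompl {G G' : SimpleGraph V} {S T : Set V} (hTS : T ⊆ S)
    (h : ∀ a b, G'.Adj a b ↔ a ≠ b ∧ (a ∈ S ↔ b ∈ S) ∧ ¬ G.Adj a b) (hT : IsSplitOn G' T) :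
    IsSplitOn G T := by
  obtain ⟨A, h1, h2⟩ := hT
  refine ⟨Aᶜ, fun a ha b hb hA hB hab => ?_, fun a ha b hb hA hB hab => ?_⟩
  · exact ((h a b).1 (h2 a ha b hb hA hB hab.ne)).2.2 hab
  · by_contra hn
    exact h1 a ha b hb (not_not.1 hA) (not_not.1 hB) ((h a b).2 ⟨hab, by simp [hTS ha, hTS hb], hn⟩)

/-- A cograph that is not `2`-polar reaches a graph with three nontrivial components. -/
theorem exists_isTripod_aux {G : SimpleGraph V} (hG : IsCograph G) (hp : ¬ IsPolar 2 2 G)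
    (S : Finset V) (hS : ∀ a b, G.Adj a b → (a ∈ S ↔ b ∈ S)) (hs : ¬ IsSplitOn G S) :
    ∃ G' p, Relation.ReflTransGen IsPartialCompl G G' ∧ IsTripod G' p := by
  classical
  induction S using Finset.strongInduction generalizing G with
  | H S ih =>
  -- If one half of a disconnected non-split `S` is not split, recurse into it. Otherwise both
  -- halves are split, and the two halves and the outside of `S` are the three parts: an edgeless
  -- half would make `S` split, an edgeless outside would make `H` polar.
  have disconnected : ∀ H : SimpleGraph V, IsCograph H → ¬ IsPolar 2 2 H →
      (∀ a b, H.Adj a b → (a ∈ S ↔ b ∈ S)) → ¬ IsSplitOn H S →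
      (∃ T : Set V, (∃ a ∈ S, a ∈ T) ∧ (∃ a ∈ S, a ∉ T) ∧
        ∀ a ∈ S, ∀ b ∈ S, a ∈ T → b ∉ T → ¬ H.Adj a b) →
      ∃ G' p, Relation.ReflTransGen IsPartialCompl H G' ∧ IsTripod G' p := by
    rintro H hH hpH hSH hsH ⟨T, ⟨t, htS, htT⟩, ⟨u, huS, huT⟩, hT⟩
    have hclosed : ∀ a b, H.Adj a b → a ∈ S → (a ∈ T ↔ b ∈ T) := by
      intro a b hab ha
      have hb := (hSH a b hab).1 ha
      have h1 := hT a ha b hb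
      have h2 := hT b hb a ha
      have h3 := hab.symm
      tauto
    by_cases hs1 : IsSplitOn H ↑(S.filter (· ∈ T))
    swap
    · refine ih _ (Finset.filter_ssubset.2 ⟨u, huS, huT⟩) hH hpH (fun a b hab => ?_) hs1
      have h1 := hSH a b hab
      have h2 := hclosed a b hab
      simp only [Finset.mem_filter]
      tauto
    by_cases hs2 : IsSplitOn H ↑(S.filter (· ∉ T))
    swap
    · refine ih _ (Finset.filter_ssubset.2 ⟨t, htS, not_not.2 htT⟩) hH hpH (fun a b hab => ?_) hs2
      have h1 := hSH a b hab
      have h2 := hclosed a b hab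
      simp only [Finset.mem_filter]
      tauto
    have hcross : ∀ a ∈ (↑(S.filter (· ∈ T)) : Set V), ∀ b ∈ (↑(S.filter (· ∉ T)) : Set V),
        ¬ H.Adj a b := by
      simp only [Finset.coe_filter, Set.mem_ofPred_eq]
      exact fun a ha b hb => hT a ha.1 b hb.1 ha.2 hb.2
    have hunion : (↑(S.filter (· ∈ T)) : Set V) ∪ ↑(S.filter (· ∉ T)) = S := by
      rw [← Finset.coe_union, Finset.filter_union_filter_not_eq]
    refine ⟨H, fun a => if a ∈ S then if a ∈ T then 0 else 1 else 2, .refl, ?_, ?_⟩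
    · intro a b hab
      have h1 := hSH a b hab
      by_cases ha : a ∈ S
      · simp [ha, h1.1 ha, hclosed a b hab ha]
      · simp [ha, mt h1.2 ha]
    · intro i
      by_contra! hno
      fin_cases i
      · refine hsH (hunion ▸ isSplitOn_of_edgeless_left hcross (fun a ha b hb hab => ?_) hs2)
        simp only [Finset.coe_filter, Set.mem_ofPred_eq] at ha hb
        exact hno a b hab (by simp [ha]) (by simp [hb])
      · refine hsH (hunion ▸ Set.union_comm _ _ ▸ isSplitOn_of_edgeless_left
          (fun a ha b hb hab => hcross b hb a ha hab.symm) (fun a ha b hb hab => ?_) hs1)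
        simp only [Finset.coe_filter, Set.mem_ofPred_eq] at ha hb
        exact hno a b hab (by simp [ha]) (by simp [hb])
      · refine hpH (isPolar_of_isSplitOn ?_ hcross (fun a b hab => ?_) hs1 hs2)
        · simp only [Finset.coe_filter, Set.mem_ofPred_eq]
          tauto
        · rw [hunion]
          by_contra ha
          have ha' : a ∉ S := ha
          exact hno a b hab (by simp [ha']) (by simp [mt (hSH a b hab).2 ha'])
  have hS2 : S.Nontrivial := by
    by_contra h
    rw [Finset.Nontrivial, Set.not_nontrivial_iff] at h
    refine hs ⟨Set.univ, fun a ha b hb _ _ hab => hab.ne (h ha hb), by simp⟩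
  obtain ⟨T, h1, h2, h | h⟩ := hG.isDecomposable S hS2
  · exact disconnected G hG hp hS hs ⟨T, h1, h2, h⟩
  -- When the complement of `G` on `S` is disconnected, splitting along `S` complements it there;
  -- cographness, non-polarity and non-splitness on `S` all survive.
  · obtain ⟨H, hH, hadj⟩ : ∃ H, IsPartialCompl G H ∧
        ∀ a b, H.Adj a b ↔ a ≠ b ∧ (a ∈ (S : Set V) ↔ b ∈ (S : Set V)) ∧ ¬ G.Adj a b := by
      refine ⟨SimpleGraph.fromRel fun a b => a ≠ b ∧ (a ∈ S ↔ b ∈ S) ∧ ¬ G.Adj a b, ?_, ?_⟩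
      · refine isPartialCompl_iff.2 ⟨S, hS, fun a b => ?_⟩
        have := G.adj_comm a b
        simp only [SimpleGraph.fromRel_adj, Finset.mem_coe]
        grind
      · intro a b
        have := G.adj_comm a b
        simp only [SimpleGraph.fromRel_adj, Finset.mem_coe]
        grind
    obtain ⟨G', p, hG', ht⟩ := disconnected H (hH.isCograph hG) (fun hp' => hp (hH.symm.isPolar hp'))
      (fun a b hab => ((hadj a b).1 hab).2.1)
      (fun hs' => hs (isSplitOn_of_partialCompl subset_rfl hadj hs'))
      ⟨T, h1, h2, fun a ha b hb haT hbT hab => ((hadj a b).1 hab).2.2 (h a ha b hb haT hbT)⟩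
    exact ⟨G', p, (Relation.ReflTransGen.single hH).trans hG', ht⟩

theorem exists_isTripod [Finite V] {G : SimpleGraph V} (hG : IsCograph G) (hp : ¬ IsPolar 2 2 G) :
    ∃ G' p, Relation.ReflTransGen IsPartialCompl G G' ∧ IsTripod G' p := by
  have := Fintype.ofFinite V
  refine exists_isTripod_aux hG hp Finset.univ (by simp) fun hs => hp ?_
  refine isPolar_of_isSplitOn (S := Set.univ) (T := ∅) (by simp) (by simp) (by simp)
    (by simpa using hs) ⟨∅, by simp, by simp⟩

/-! ### Concrete copies of the obstructions -/

/-- The graph on `Fin n` whose edges are the pairs in a list. -/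
def ofPairs (n : ℕ) (E : List (Fin n × Fin n)) : SimpleGraph (Fin n) where
  Adj a b := a ≠ b ∧ ((a, b) ∈ E ∨ (b, a) ∈ E)
  symm := ⟨fun _ _ h => ⟨h.1.symm, h.2.symm⟩⟩
  loopless := ⟨fun _ h => h.1 rfl⟩

instance (n : ℕ) (E : List (Fin n × Fin n)) : DecidableRel (ofPairs n E).Adj :=
  fun _ _ => inferInstanceAs (Decidable (_ ∧ _))

/-- A copy of `K₁ + 3K₂` on `Fin 7`. -/
abbrev H1 : SimpleGraph (Fin 7) := ofPairs 7 [(1, 2), (3, 4), (5, 6)]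

/-- A copy of `2P₃ + K₂` on `Fin 8`. -/
abbrev H6 : SimpleGraph (Fin 8) := ofPairs 8 [(0, 1), (1, 2), (3, 4), (4, 5), (6, 7)]

/-- A copy of `C₄ + K₂ + 2K₁` on `Fin 8`. -/
abbrev H13 : SimpleGraph (Fin 8) := ofPairs 8 [(0, 1), (1, 2), (2, 3), (0, 3), (4, 5)]

/-- A copy of `K₃,₃ + 3K₁` on `Fin 9`. -/
abbrev H21 : SimpleGraph (Fin 9) :=
  ofPairs 9 [(0, 3), (0, 4), (0, 5), (1, 3), (1, 4), (1, 5), (2, 3), (2, 4), (2, 5)]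

/-- The disjoint union of two edges and a diamond. -/
abbrev H13' : SimpleGraph (Fin 8) :=
  ofPairs 8 [(0, 2), (1, 3), (4, 6), (4, 7), (5, 6), (5, 7), (6, 7)]

/-- The disjoint union of three triangles. -/
abbrev H21' : SimpleGraph (Fin 9) :=
  ofPairs 9 [(0, 1), (0, 2), (1, 2), (3, 4), (3, 5), (4, 5), (6, 7), (6, 8), (7, 8)]

theorem nonempty_embedding {n : ℕ} {E : List (Fin n × Fin n)} {G : SimpleGraph V} (f : Fin n → V)
    (hf : ∀ i j, i < j → f i ≠ f j ∧ (G.Adj (f i) (f j) ↔ (ofPairs n E).Adj i j)) :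
    Nonempty (ofPairs n E ↪g G) := by
  refine ⟨⟨⟨f, fun i j hij => ?_⟩, fun {i j} => ?_⟩⟩
  · by_contra h
    rcases lt_or_gt_of_ne h with h | h
    · exact (hf _ _ h).1 hij
    · exact (hf _ _ h).1 hij.symm
  · change G.Adj (f i) (f j) ↔ _
    rcases lt_trichotomy i j with h | rfl | h
    · exact (hf _ _ h).2
    · simp
    · rw [G.adj_comm, (ofPairs n E).adj_comm]
      exact (hf _ _ h).2

/-! ### Obstructions inside a graph with three nontrivial parts -/

variable {G : SimpleGraph V} {p : V → Fin 3}

theorem IsTripod.ne_and_not_adj (h : IsTripod G p) {a b : V} {i j : Fin 3} (ha : p a = i)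
    (hb : p b = j) (hij : i ≠ j) : a ≠ b ∧ ¬ G.Adj a b := by
  refine ⟨?_, fun hab => hij (ha ▸ hb ▸ h.1 a b hab)⟩
  rintro rfl
  exact hij (ha ▸ hb)

/-- By `hm` no triple inside a part spans exactly one edge. Hence the triangle-free part `i` has
only even triples, and the other two parts are the two cliques. -/
theorem IsTripod.isPolar (h : IsTripod G p)
    (hm : ∀ x y z, G.Adj y z → p x = p y → G.Adj x y ∨ G.Adj x z) (i : Fin 3)
    (hi : ∀ a b c, G.Adj a b → G.Adj b c → G.Adj a c → p a ≠ i)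
    (hc : ∀ a b, p a = p b → p a ≠ i → a ≠ b → G.Adj a b) : IsPolar 2 2 G := by
  refine isPolar_two_two_iff.2 ⟨{a | p a = i}, fun a b c hab hbc hac => ?_⟩
  simp only [Set.mem_ofPred_eq]
  refine ⟨fun ha hb hc => ?_, fun ha hb hc' => ?_⟩
  · have h1 := hi a b c
    have h2 := hm a b c
    have h3 := hm b a c
    have h4 := hm c a b
    simp only [ha, hb, hc, G.adj_comm b a, G.adj_comm c a, G.adj_comm c b, OddTriple] at *
    tauto
  · have key : ∀ x y, x ≠ y → p x ≠ i → (G.Adj x y ↔ p x = p y) :=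
      fun x y hxy hx => ⟨h.1 x y, fun hp => hc x y hp hx hxy⟩
    rw [OddTriple, key a b hab ha, key b c hbc hb, key a c hac ha]
    generalize p a = x, p b = y, p c = z at *
    clear hi hc key
    revert i x y z
    decide

theorem exists_two_others (i : Fin 3) : ∃ j k : Fin 3, i ≠ j ∧ i ≠ k ∧ j ≠ k := by
  revert i
  decide

theorem exists_third (i j : Fin 3) : ∃ k : Fin 3, i ≠ k ∧ j ≠ k := by
  revert i j
  decide

theorem IsTripod.exists_embedding_H1 (h : IsTripod G p) {x y z : V} (hyz : G.Adj y z)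
    (hxy : ¬ G.Adj x y) (hxz : ¬ G.Adj x z) (hp : p x = p y) : Nonempty (H1 ↪g G) := by
  obtain ⟨j, k, hij, hik, hjk⟩ := exists_two_others (p x)
  obtain ⟨a, b, hab, ha, hb⟩ := h.2 j
  obtain ⟨c, d, hcd, hc, hd⟩ := h.2 k
  have hne1 : x ≠ y := by rintro rfl; exact hxz hyz
  have hne2 : x ≠ z := by rintro rfl; exact hxy hyz.symm
  have hx : p x = p x := rfl
  have hy : p y = p x := hp.symm
  have hz : p z = p x := (h.1 y z hyz) ▸ hy
  refine nonempty_embedding ![x, y, z, a, b, c, d] fun s t hst => ?_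
  fin_cases s <;> fin_cases t <;> first
    | exact absurd hst (by decide)
    | (simp [ofPairs]
       first
       | exact h.ne_and_not_adj (by assumption) (by assumption) (by assumption)
       | exact ⟨SimpleGraph.Adj.ne (by assumption), by assumption⟩
       | exact ⟨by assumption, by assumption⟩)

theorem IsTripod.exists_embedding_H6 (h : IsTripod G p) {a b c x y z : V} (hab : G.Adj a b)
    (hbc : G.Adj b c) (hac : ¬ G.Adj a c) (hac' : a ≠ c) (hxy : G.Adj x y) (hyz : G.Adj y z)
    (hxz : ¬ G.Adj x z) (hxz' : x ≠ z) (hp : p a ≠ p x) : Nonempty (H6 ↪g G) := by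
  obtain ⟨k, hk1, hk2⟩ := exists_third (p a) (p x)
  obtain ⟨u, v, huv, hu, hv⟩ := h.2 k
  have ha : p a = p a := rfl
  have hb : p b = p a := (h.1 a b hab).symm
  have hc : p c = p a := (h.1 b c hbc) ▸ hb
  have hx : p x = p x := rfl
  have hy : p y = p x := (h.1 x y hxy).symm
  have hz : p z = p x := (h.1 y z hyz) ▸ hy
  refine nonempty_embedding ![a, b, c, x, y, z, u, v] fun s t hst => ?_
  fin_cases s <;> fin_cases t <;> first
    | exact absurd hst (by decide)
    | (simp [ofPairs]
       first
       | exact h.ne_and_not_adj (by assumption) (by assumption) (by assumption)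
       | exact ⟨SimpleGraph.Adj.ne (by assumption), by assumption⟩
       | exact ⟨by assumption, by assumption⟩)

theorem IsTripod.exists_embedding_H13' (h : IsTripod G p) {a b u v : V} (hab : ¬ G.Adj a b)
    (hab' : a ≠ b) (hau : G.Adj a u) (hav : G.Adj a v) (hbu : G.Adj b u) (hbv : G.Adj b v)
    (huv : G.Adj u v) : Nonempty (H13' ↪g G) := by
  obtain ⟨j, k, hij, hik, hjk⟩ := exists_two_others (p a)
  obtain ⟨w, x, hwx, hw, hx⟩ := h.2 j
  obtain ⟨y, z, hyz, hy, hz⟩ := h.2 k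
  have ha : p a = p a := rfl
  have hu : p u = p a := (h.1 a u hau).symm
  have hv : p v = p a := (h.1 a v hav).symm
  have hb : p b = p a := (h.1 b u hbu).trans hu
  have hji := hij.symm
  have hki := hik.symm
  -- The two edges are interleaved because in `H13'` they are the diagonals of the `4`-cycle of
  -- `H13`.
  refine nonempty_embedding ![w, y, x, z, a, b, u, v] fun s t hst => ?_
  fin_cases s <;> fin_cases t <;> first
    | exact absurd hst (by decide)
    | (simp [ofPairs]
       first
       | exact h.ne_and_not_adj (by assumption) (by assumption) (by assumption)
       | exact h.ne_and_not_adj (by assumption) (by assumption) (Ne.symm (by assumption))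
       | exact ⟨SimpleGraph.Adj.ne (by assumption), by assumption⟩
       | exact ⟨by assumption, by assumption⟩)

theorem IsTripod.exists_embedding_H21' (h : IsTripod G p)
    (ht : ∀ i, ∃ a b c, G.Adj a b ∧ G.Adj b c ∧ G.Adj a c ∧ p a = i) : Nonempty (H21' ↪g G) := by
  obtain ⟨a, b, c, hab, hbc, hac, ha⟩ := ht 0
  obtain ⟨u, v, w, huv, hvw, huw, hu⟩ := ht 1
  obtain ⟨x, y, z, hxy, hyz, hxz, hx⟩ := ht 2
  have hb : p b = 0 := (h.1 a b hab) ▸ ha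
  have hc : p c = 0 := (h.1 a c hac) ▸ ha
  have hv : p v = 1 := (h.1 u v huv) ▸ hu
  have hw : p w = 1 := (h.1 u w huw) ▸ hu
  have hy : p y = 2 := (h.1 x y hxy) ▸ hx
  have hz : p z = 2 := (h.1 x z hxz) ▸ hx
  have h1 : (0 : Fin 3) ≠ 1 := by decide
  have h2 : (0 : Fin 3) ≠ 2 := by decide
  have h3 : (1 : Fin 3) ≠ 2 := by decide
  refine nonempty_embedding ![a, b, c, u, v, w, x, y, z] fun s t hst => ?_
  fin_cases s <;> fin_cases t <;> first
    | exact absurd hst (by decide)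
    | (simp [ofPairs]
       first
       | exact h.ne_and_not_adj (by assumption) (by assumption) (by assumption)
       | exact ⟨SimpleGraph.Adj.ne (by assumption), by assumption⟩)


/-- A graph with three nontrivial components and no induced `K₁ + 3K₂`, `2P₃ + K₂`,
`diamond + 2K₂` or `3K₃` is `2`-polar. -/
theorem IsTripod.exists_embedding (h : IsTripod G p) (hG : ¬ IsPolar 2 2 G) :
    Nonempty (H1 ↪g G) ∨ Nonempty (H6 ↪g G) ∨ Nonempty (H13' ↪g G) ∨ Nonempty (H21' ↪g G) := by
  by_cases hm : ∀ x y z, G.Adj y z → p x = p y → G.Adj x y ∨ G.Adj x z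
  swap
  · push Not at hm
    obtain ⟨x, y, z, hyz, hp, hxy, hxz⟩ := hm
    exact Or.inl (h.exists_embedding_H1 hyz hxy hxz hp)
  refine Or.inr ?_
  -- Under `hm`, nonadjacent vertices of a part have the same neighbours, and none is isolated
  -- because the part has an edge; so each such pair ends an induced `P₃`.
  have hpath : ∀ a c, p a = p c → a ≠ c → ¬ G.Adj a c → ∃ b, G.Adj a b ∧ G.Adj b c := by
    intro a c hp hac hn
    have key : ∀ b, G.Adj a b → G.Adj b c := fun b hab =>
      ((hm c a b hab hp.symm).resolve_left fun hc => hn hc.symm).symm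
    obtain ⟨y, z, hyz, hy, -⟩ := h.2 (p a)
    rcases hm a y z hyz hy.symm with hb | hb
    · exact ⟨y, hb, key _ hb⟩
    · exact ⟨z, hb, key _ hb⟩
  by_cases h6 : ∃ a c x z, p a = p c ∧ a ≠ c ∧ ¬ G.Adj a c ∧ p x = p z ∧ x ≠ z ∧ ¬ G.Adj x z ∧
      p a ≠ p x
  · obtain ⟨a, c, x, z, h1, h2, h3, h4, h5, h6, h7⟩ := h6
    obtain ⟨b, hab, hbc⟩ := hpath a c h1 h2 h3
    obtain ⟨y, hxy, hyz⟩ := hpath x z h4 h5 h6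
    exact Or.inl (h.exists_embedding_H6 hab hbc h3 h2 hxy hyz h6 h5 h7)
  refine Or.inr ?_
  push Not at h6
  -- If all parts other than `i` are cliques, part `i` has a triangle, as otherwise `G` is polar.
  have htri : ∀ i, (∀ a b, p a = p b → p a ≠ i → a ≠ b → G.Adj a b) →
      ∃ a b c, G.Adj a b ∧ G.Adj b c ∧ G.Adj a c ∧ p a = i := by
    intro i hc
    by_contra! hno
    exact hG (h.isPolar hm i hno hc)
  by_cases hc : ∃ a b, p a = p b ∧ a ≠ b ∧ ¬ G.Adj a b
  · obtain ⟨a, b, hp, hne, hn⟩ := hc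
    have hother : ∀ x z, p x = p z → p x ≠ p a → x ≠ z → G.Adj x z := by
      intro x z hxz hxa hne'
      by_contra hn'
      exact hxa (h6 a b x z hp hne hn hxz hne' hn').symm
    obtain ⟨x, y, z, hxy, hyz, hxz, hx⟩ := htri _ hother
    have hy : p y = p a := (h.1 x y hxy) ▸ hx
    have key : ∀ u, G.Adj a u → G.Adj b u := fun u hau =>
      (hm b a u hau hp.symm).resolve_left fun hc => hn hc.symm
    -- By `hm`, `a` misses at most one vertex of the triangle; its twin `b` sees the same two, which
    -- gives the diamond.
    obtain ⟨u, v, huv, hau, hav⟩ : ∃ u v, G.Adj u v ∧ G.Adj a u ∧ G.Adj a v := by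
      rcases hm a x y hxy hx.symm with h1 | h1
      · rcases hm a y z hyz hy.symm with h2 | h2
        · exact ⟨x, y, hxy, h1, h2⟩
        · exact ⟨x, z, hxz, h1, h2⟩
      · rcases hm a x z hxz hx.symm with h2 | h2
        · exact ⟨x, y, hxy, h2, h1⟩
        · exact ⟨y, z, hyz, h1, h2⟩
    exact Or.inl (h.exists_embedding_H13' hn hne hau hav (key u hau) (key v hav) huv)
  · push Not at hc
    exact Or.inr (h.exists_embedding_H21' fun i => htri i fun a b hp _ hne => hc a b hp hne)

/-! ### Finite verification of the four obstructions -/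

instance (G : SimpleGraph V) [DecidableRel G.Adj] (a b c : V) : Decidable (OddTriple G a b c) :=
  inferInstanceAs (Decidable (_ ↔ (_ ↔ _)))

theorem oddTriple_swap_left (G : SimpleGraph V) (a b c : V) :
    OddTriple G a b c ↔ OddTriple G b a c := by
  rw [OddTriple, OddTriple, G.adj_comm b a]
  tauto

theorem oddTriple_swap_right (G : SimpleGraph V) (a b c : V) :
    OddTriple G a b c ↔ OddTriple G a c b := by
  rw [OddTriple, OddTriple, G.adj_comm c b]
  tauto

theorem isParityPartition_of_lt [LinearOrder V] {G : SimpleGraph V} {A : Set V}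
    (h : ∀ a b c, a < b → b < c →
      (a ∈ A → b ∈ A → c ∈ A → ¬ OddTriple G a b c) ∧
      (a ∉ A → b ∉ A → c ∉ A → OddTriple G a b c)) : IsParityPartition G A := by
  intro a b c hab hbc hac
  rcases hab.lt_or_gt with hab | hab <;> rcases hbc.lt_or_gt with hbc | hbc
  · exact h a b c hab hbc
  · rcases hac.lt_or_gt with hac | hac
    · rw [oddTriple_swap_right]
      have := h a c b hac hbc
      tauto
    · rw [oddTriple_swap_right, oddTriple_swap_left]
      have := h c a b hac hab
      tauto
  · rcases hac.lt_or_gt with hac | hac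
    · rw [oddTriple_swap_left]
      have := h b a c hab hac
      tauto
    · rw [oddTriple_swap_left, oddTriple_swap_right]
      have := h b c a hbc hac
      tauto
  · rw [oddTriple_swap_left, oddTriple_swap_right, oddTriple_swap_left]
    have := h c b a hbc hab
    tauto

/-- The bits of `m` encode a candidate side `A`; each candidate is refuted by a triple on one side
with the wrong parity. Ranging over numbers makes the check decidable by evaluation. -/
theorem not_isPolar_of_testBit {n : ℕ} {G : SimpleGraph (Fin n)}
    (h : ∀ m < 2 ^ n, ∃ a b c : Fin n, a < b ∧ b < c ∧ m.testBit a = m.testBit b ∧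
      m.testBit b = m.testBit c ∧ (m.testBit a = true ↔ OddTriple G a b c)) :
    ¬ IsPolar 2 2 G := by
  classical
  rw [isPolar_two_two_iff]
  rintro ⟨A, hA⟩
  obtain ⟨a, b, c, hab, hbc, h1, h2, h3⟩ :=
    h (Nat.ofBits fun i : Fin n => decide (i ∈ A)) (Nat.ofBits_lt_two_pow _)
  simp only [Nat.testBit_ofBits_lt _ _ (Fin.is_lt _), Fin.eta, decide_eq_decide,
    decide_eq_true_eq] at h1 h2 h3
  have := hA a b c hab.ne hbc.ne (hab.trans hbc).ne
  tauto

/-- Every proper induced subgraph misses some vertex `v`, so one partition of the graph without `v`,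
encoded in the bits of `w v`, serves them all. -/
theorem isPolar_induce_of_testBit {n : ℕ} {G : SimpleGraph (Fin n)} (w : Fin n → ℕ)
    (h : ∀ v a b c : Fin n, a < b → b < c → a ≠ v → b ≠ v → c ≠ v →
      (w v).testBit a = (w v).testBit b → (w v).testBit b = (w v).testBit c →
      ((w v).testBit a = false ↔ OddTriple G a b c)) {S : Set (Fin n)} (hS : S ≠ Set.univ) :
    IsPolar 2 2 (G.induce S) := by
  obtain ⟨v, hv⟩ := (Set.ne_univ_iff_exists_notMem S).1 hS
  refine isPolar_two_two_iff.2 ⟨{a | (w v).testBit a = true},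
    isParityPartition_of_lt fun a b c hab hbc => ?_⟩
  have hne : ∀ a : S, (a : Fin n) ≠ v := fun a ha => hv (ha ▸ a.2)
  have key : OddTriple (G.induce S) a b c ↔ OddTriple G a b c := Iff.rfl
  rw [key]
  have := h v a b c hab hbc (hne a) (hne b) (hne c)
  simp only [Set.mem_ofPred_eq, Bool.not_eq_true]
  constructor
  · intro ha hb hc
    rw [← this (ha.trans hb.symm) (hb.trans hc.symm), ha]
    simp
  · intro ha hb hc
    exact (this (ha.trans hb.symm) (hb.trans hc.symm)).1 ha

theorem isCographObstruction_H1 : IsCographObstruction H1 :=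
  ⟨isCograph_iff.2 (by decide +kernel), not_isPolar_of_testBit (by decide +kernel),
    fun _ => isPolar_induce_of_testBit ![6, 5, 3, 17, 9, 65, 33] (by decide +kernel)⟩

theorem isCographObstruction_H6 : IsCographObstruction H6 :=
  ⟨isCograph_iff.2 (by decide +kernel), not_isPolar_of_testBit (by decide +kernel),
    fun _ => isPolar_induce_of_testBit ![56, 13, 56, 7, 41, 7, 137, 73] (by decide +kernel)⟩

theorem isCographObstruction_H13 : IsCographObstruction H13 :=
  ⟨isCograph_iff.2 (by decide +kernel), not_isPolar_of_testBit (by decide +kernel),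
    fun _ => isPolar_induce_of_testBit ![194, 193, 194, 193, 229, 213, 15, 15] (by decide +kernel)⟩

theorem isCographObstruction_H21 : IsCographObstruction H21 :=
  ⟨isCograph_iff.2 (by decide +kernel), not_isPolar_of_testBit (by decide +kernel),
    fun _ => isPolar_induce_of_testBit ![504, 504, 504, 455, 455, 455, 63, 63, 63]
      (by decide +kernel)⟩

theorem isPartialCompl_H13 : IsPartialCompl H13 H13' :=
  -- Complementing `C₄` gives `2K₂`; complementing `K₂ + 2K₁` gives the diamond.
  isPartialCompl_iff.2 ⟨{a | a < 4}, by simp only [Set.mem_ofPred_eq]; decide +kernel,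
    by simp only [Set.mem_ofPred_eq]; decide +kernel⟩

theorem isPartialCompl_H21 : IsPartialCompl H21 H21' :=
  -- Complementing `K₃,₃` gives `2K₃`; complementing `3K₁` gives the third triangle.
  isPartialCompl_iff.2 ⟨{a | a < 6}, by simp only [Set.mem_ofPred_eq]; decide +kernel,
    by simp only [Set.mem_ofPred_eq]; decide +kernel⟩

theorem reachable_H13 : PartialComplReachable H13 H13' :=
  ⟨H13', .single isPartialCompl_H13, ⟨Iso.refl⟩⟩

theorem reachable_H21 : PartialComplReachable H21 H21' :=
  ⟨H21', .single isPartialCompl_H21, ⟨Iso.refl⟩⟩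

/-! ### The named graphs and their copies on `Fin n` -/

theorem nonempty_iso_of_equiv {G : SimpleGraph V} {H : SimpleGraph W} (e : V ≃ W)
    (h : ∀ a b, H.Adj (e a) (e b) ↔ G.Adj a b) : Nonempty (G ≃g H) :=
  ⟨⟨e, h _ _⟩⟩

theorem nonempty_iso_F1 : Nonempty (F1 ≃g H1) := by
  refine nonempty_iso_of_equiv ((Equiv.sumCongr (.refl _)
    ((Equiv.sumCongr (.refl _) finSumFinEquiv).trans finSumFinEquiv)).trans finSumFinEquiv) ?_
  unfold F1
  simp [Fin.forall_fin_succ, ofPairs, finSumFinEquiv]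

theorem nonempty_iso_F6 : Nonempty (F6 ≃g H6) := by
  refine nonempty_iso_of_equiv
    ((Equiv.sumCongr (.refl _) finSumFinEquiv).trans finSumFinEquiv) ?_
  unfold F6
  simp [Fin.forall_fin_succ, ofPairs, finSumFinEquiv, pathGraph_adj]

theorem nonempty_iso_F13 : Nonempty (F13 ≃g H13) := by
  refine nonempty_iso_of_equiv ((Equiv.sumCongr (.refl _)
    ((Equiv.sumCongr (.refl _) finSumFinEquiv).trans finSumFinEquiv)).trans finSumFinEquiv) ?_
  unfold F13
  simp [Fin.forall_fin_succ, ofPairs, finSumFinEquiv, cycleGraph_adj]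
  decide

theorem nonempty_iso_F21 : Nonempty (F21 ≃g H21) := by
  refine nonempty_iso_of_equiv ((Equiv.sumCongr finSumFinEquiv
    ((Equiv.sumCongr (.refl _) finSumFinEquiv).trans finSumFinEquiv)).trans finSumFinEquiv) ?_
  unfold F21
  simp [Fin.forall_fin_succ, ofPairs, finSumFinEquiv]

/-! ### Classification -/

theorem exists_reachable [Finite V] {G : SimpleGraph V} (hG : IsCographObstruction G) :
    PartialComplReachable H1 G ∨ PartialComplReachable H6 G ∨ PartialComplReachable H13 G ∨
      PartialComplReachable H21 G := by
  obtain ⟨G', p, hG', hp⟩ := exists_isTripod hG.1 hG.2.1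
  have hr : PartialComplReachable G' G := PartialComplReachable.symm ⟨G', hG', ⟨Iso.refl⟩⟩
  have hm := (hG.of_reflTransGen hG').2
  -- An obstruction contained in the minimal obstruction `G'` must be all of it.
  have key : ∀ {n : ℕ} {H K : SimpleGraph (Fin n)}, IsCographObstruction H →
      PartialComplReachable H K → Nonempty (K ↪g G') → PartialComplReachable H G := by
    rintro n H K hH hHK ⟨e⟩
    obtain ⟨e'⟩ := hm.nonempty_iso e (hH.of_reachable hHK).2.1
    exact hHK.trans ((reachable_of_iso e').trans hr)
  exact (hp.exists_embedding hm.1).imp (key isCographObstruction_H1 (.refl _))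
    (Or.imp (key isCographObstruction_H6 (.refl _))
      (Or.imp (key isCographObstruction_H13 reachable_H13)
        (key isCographObstruction_H21 reachable_H21)))

theorem isCographObstruction_iff [Finite V] {G : SimpleGraph V} :
    IsCographObstruction G ↔ PartialComplReachable H1 G ∨ PartialComplReachable H6 G ∨
      PartialComplReachable H13 G ∨ PartialComplReachable H21 G := by
  refine ⟨exists_reachable, ?_⟩
  rintro (h | h | h | h)
  · exact isCographObstruction_H1.of_reachable h
  · exact isCographObstruction_H6.of_reachable h
  · exact isCographObstruction_H13.of_reachable h
  · exact isCographObstruction_H21.of_reachable h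

theorem reachable_congr {X : Type w} {G : SimpleGraph V} {H : SimpleGraph W}
    (h : Nonempty (G ≃g H)) {K : SimpleGraph X} :
    PartialComplReachable G K ↔ PartialComplReachable H K :=
  h.elim fun e => ⟨(reachable_of_iso e.symm).trans, (reachable_of_iso e).trans⟩

/-! ### Counting the equivalence classes -/

theorem card_eq_of_reachable {m n : ℕ} {G : SimpleGraph (Fin m)} {H : SimpleGraph (Fin n)}
    (h : PartialComplReachable G H) : m = n := by
  obtain ⟨G', -, ⟨e⟩⟩ := h
  simpa using Fintype.card_congr e.toEquiv

/-- Partial complementation changes the parity of either every triple or none. -/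
theorem oddTriple_of_reachable {G : SimpleGraph V} {H : SimpleGraph W}
    (h : PartialComplReachable G H) : ∃ e : V ≃ W,
      (∀ a b c, a ≠ b → b ≠ c → a ≠ c → (OddTriple H (e a) (e b) (e c) ↔ OddTriple G a b c)) ∨
      (∀ a b c, a ≠ b → b ≠ c → a ≠ c → (OddTriple H (e a) (e b) (e c) ↔ ¬ OddTriple G a b c)) := by
  obtain ⟨G', hG', ⟨e⟩⟩ := h
  refine ⟨e.toEquiv, ?_⟩
  have he : ∀ a b c, OddTriple H (e a) (e b) (e c) ↔ OddTriple G' a b c := fun a b c => by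
    simp only [OddTriple, e.map_adj_iff]
  change (∀ a b c, a ≠ b → b ≠ c → a ≠ c → (OddTriple H (e a) (e b) (e c) ↔ _)) ∨
    (∀ a b c, a ≠ b → b ≠ c → a ≠ c → (OddTriple H (e a) (e b) (e c) ↔ _))
  simp only [he]
  clear he e
  induction hG' with
  | refl => simp
  | tail _ h ih =>
    refine ih.symm.imp (fun ih a b c hab hbc hac => ?_) (fun ih a b c hab hbc hac => ?_)
    · rw [h.oddTriple_iff hab hbc hac, ih a b c hab hbc hac, not_not]
    · rw [h.oddTriple_iff hab hbc hac, ih a b c hab hbc hac]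

/-- The number of ordered triples of distinct elements that satisfy `P`. -/
def tripleCount {n : ℕ} (P : Fin n → Fin n → Fin n → Prop) [∀ a b c, Decidable (P a b c)] : ℕ :=
  Fintype.card {t : Fin n × Fin n × Fin n //
    t.1 ≠ t.2.1 ∧ t.2.1 ≠ t.2.2 ∧ t.1 ≠ t.2.2 ∧ P t.1 t.2.1 t.2.2}

theorem tripleCount_congr {n : ℕ} {P Q : Fin n → Fin n → Fin n → Prop}
    [∀ a b c, Decidable (P a b c)] [∀ a b c, Decidable (Q a b c)] (e : Fin n ≃ Fin n)
    (h : ∀ a b c, a ≠ b → b ≠ c → a ≠ c → (Q (e a) (e b) (e c) ↔ P a b c)) :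
    tripleCount P = tripleCount Q := by
  refine Fintype.card_congr ((e.prodCongr (e.prodCongr e)).subtypeEquiv fun t => ?_)
  simp only [Equiv.prodCongr_apply, Prod.map_fst, Prod.map_snd, ne_eq,
    EmbeddingLike.apply_eq_iff_eq]
  exact and_congr_right fun h1 => and_congr_right fun h2 => and_congr_right fun h3 =>
    (h _ _ _ h1 h2 h3).symm

/-- Of the 56 triples, `H13` has 22 odd ones, while `H6` has 26 odd and 30 even ones. Each is
counted six times, once per ordering, and neither 26 nor 30 matches 22. -/
theorem not_reachable_H6_H13 : ¬ PartialComplReachable H6 H13 := by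
  intro h
  have h0 : tripleCount (OddTriple H13) = 132 := by decide +kernel
  obtain ⟨e, he | he⟩ := oddTriple_of_reachable h
  · have h1 : tripleCount (OddTriple H6) = 156 := by decide +kernel
    have := tripleCount_congr e he
    omega
  · have h1 : tripleCount (fun a b c => ¬ OddTriple H6 a b c) = 180 := by decide +kernel
    have := tripleCount_congr e he
    omega

theorem obstructionClasses_eq : obstructionClasses =
    {Quotient.mk partialComplSetoid ⟨7, H1⟩, Quotient.mk partialComplSetoid ⟨8, H6⟩,
      Quotient.mk partialComplSetoid ⟨8, H13⟩, Quotient.mk partialComplSetoid ⟨9, H21⟩} := by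
  ext q
  induction q using Quotient.inductionOn with
  | h G =>
  have hmk : ∀ {n : ℕ} {H : SimpleGraph (Fin n)},
      Quotient.mk partialComplSetoid G = Quotient.mk partialComplSetoid ⟨n, H⟩ ↔
        PartialComplReachable H G.2 :=
    Quotient.eq.trans ⟨fun h => PartialComplReachable.symm h, fun h => PartialComplReachable.symm h⟩
  simp only [Set.mem_insert_iff, Set.mem_singleton_iff, hmk]
  rw [← isCographObstruction_iff]
  constructor
  · rintro ⟨H, hH, hHG⟩
    exact IsCographObstruction.of_reachable hH (Quotient.exact hHG)
  · exact fun h => ⟨G, h, rfl⟩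

theorem encard_obstructionClasses : obstructionClasses.encard = 4 := by
  have hne : ∀ {m n : ℕ} {G : SimpleGraph (Fin m)} {H : SimpleGraph (Fin n)},
      ¬ PartialComplReachable G H →
      Quotient.mk partialComplSetoid ⟨m, G⟩ ≠ Quotient.mk partialComplSetoid ⟨n, H⟩ :=
    fun h h' => h (Quotient.exact h')
  have hcard : ∀ {m n : ℕ} {G : SimpleGraph (Fin m)} {H : SimpleGraph (Fin n)}, m ≠ n →
      Quotient.mk partialComplSetoid ⟨m, G⟩ ≠ Quotient.mk partialComplSetoid ⟨n, H⟩ :=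
    fun h => hne fun h' => h (card_eq_of_reachable h')
  rw [obstructionClasses_eq, Set.encard_insert_of_notMem, Set.encard_insert_of_notMem,
    Set.encard_insert_of_notMem, Set.encard_singleton]
  · norm_num
  · exact hcard (by decide)
  · rintro (h | h)
    · exact hne not_reachable_H6_H13 h
    · exact hcard (by decide) h
  · rintro (h | h | h)
    · exact hcard (by decide) h
    · exact hcard (by decide) h
    · exact hcard (by decide) h

end PolarCograph

theorem theorem4p6 :
    (∀ {V : Type u} [Finite V] (G : SimpleGraph V),
      (PolarCograph.IsCograph G ∧ PolarCograph.IsMinimalPolarObstruction 2 G) ↔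
        (PolarCograph.PartialComplReachable PolarCograph.F1 G ∨
          PolarCograph.PartialComplReachable PolarCograph.F6 G ∨
          PolarCograph.PartialComplReachable PolarCograph.F13 G ∨
          PolarCograph.PartialComplReachable PolarCograph.F21 G)) ∧
    PolarCograph.obstructionClasses.encard = 4 := by
  refine ⟨fun G => ?_, PolarCograph.encard_obstructionClasses⟩
  rw [PolarCograph.reachable_congr PolarCograph.nonempty_iso_F1,
    PolarCograph.reachable_congr PolarCograph.nonempty_iso_F6,
    PolarCograph.reachable_congr PolarCograph.nonempty_iso_F13,
    PolarCograph.reachable_congr PolarCograph.nonempty_iso_F21]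
  exact PolarCograph.isCographObstruction_iff
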